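/- Let $F$ be the free group of rank $2$ on the generators $a,b$, let $X$ be the rose with petals $a,b$, and let $L>0$ be an integer divisible by $4$. A \emph{loop of length $L$} is a cyclically reduced cyclic word of length $L$ in $a^{\pm1},b^{\pm1}$ (equivalently, an immersed oriented simplicial loop of length $L$ in $X$, up to the choice of its starting point); let $S'(L)$ be the finite set of these loops, and let $\mathbf 1'\in\mathbb Q[S'(L)]$ be the vector with all coordinates equal to $1$. A vector $v\in\mathbb Q[S'(L)]$ is \emph{homologically trivial} if $\sum_{\gamma}v_\gamma[\gamma]=0$ in $H_1(F;\mathbb Q)$. A \emph{folded fatgraph} over $X$ is a finite graph $Y$ with a cyclic order on the edges at each vertex and a locally injective simplicial map $Y\to X$; it has a canonical fattening to an oriented surface $S(Y)$, and its boundary $\partial S(Y)$ is a collection of cyclic words. A \emph{good pair of pants} is a trivalent folded fatgraph $Y$ for which $S(Y)$ is a pair of pants, all of whose edges have length exactly $L/2$ and whose boundary consists of loops of length $L$. A \emph{good annulus} is a folded fatgraph $Y$ for which $S(Y)$ is an annulus and whose boundary consists of two loops of length $L$. A vector $w$ \emph{bounds a collection of good pants and annuli} if there is a finite collection of good pairs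 of pants and good annuli whose total boundary contains each loop $\gamma\in S'(L)$ exactly $w_\gamma$ times. Then for every homologically trivial vector $v\in\mathbb Q[S'(L)]$ with integer coordinates there is $n\in\mathbb N$ such that $v+n\mathbf 1'$ bounds a collection of good pants and annuli. -/

import Mathlib

/-! Words in the letters `α × Bool`: the letter `(i, true)` is the generator `i` of the free group on
`α`, the letter `(i, false)` is its inverse. -/

/-- `c` is an untagged loop of length `L`: a cyclic word with `L` letters which is cyclically reduced
(no two cyclically consecutive letters are mutually inverse). Equivalently, an immersed oriented loop
of length `L` in the rose with petals `α`, up to the choice of the starting point. -/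
def IsLoop {α : Type*} (L : ℕ) (c : Cycle (α × Bool)) : Prop :=
  c.length = L ∧ c.Chain (fun x y => x.1 = y.1 → x.2 = y.2)

/-- The set of untagged loops of length `L` over the free group on `α`. -/
abbrev Loop (α : Type*) (L : ℕ) : Type _ := {c : Cycle (α × Bool) // IsLoop L c}

instance Loop.instFinite {α : Type*} [Finite α] (L : ℕ) : Finite (Loop α L) := by
  have hfin : Finite {l : List (α × Bool) // l.length = L} := List.finite_length_eq (α × Bool) L
  have hfin' : Finite {c : Cycle (α × Bool) // c.length = L} := by
    refine Finite.of_surjective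
      (fun l : {l : List (α × Bool) // l.length = L} =>
        (⟨(l.1 : Cycle (α × Bool)), l.2⟩ : {c : Cycle (α × Bool) // c.length = L})) ?_
    rintro ⟨c, hc⟩
    induction c using Quotient.inductionOn with
    | _ l => exact ⟨⟨l, hc⟩, rfl⟩
  exact Finite.of_injective
    (fun c : Loop α L => (⟨c.1, c.2.1⟩ : {c : Cycle (α × Bool) // c.length = L}))
    (fun c d h => Subtype.ext (congrArg (fun x => x.1) h))

noncomputable instance Loop.instFintype {α : Type*} [Finite α] (L : ℕ) : Fintype (Loop α L) :=
  Fintype.ofFinite _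

/-- The homology class of a cyclic word: the vector of its exponent sums. -/
def homologyClass {α : Type*} [DecidableEq α] (c : Cycle (α × Bool)) : α → ℚ := fun i =>
  (c.toMultiset.count (i, true) : ℚ) - (c.toMultiset.count (i, false) : ℚ)

/-- The linear map from the rational vector space spanned by the loops of length `L` to rational
homology which takes every loop to its homology class. -/
noncomputable def homologyMap (α : Type*) [Finite α] [DecidableEq α] (L : ℕ) :
    (Loop α L → ℚ) →ₗ[ℚ] (α → ℚ) :=
  Fintype.linearCombination ℚ (fun γ : Loop α L => homologyClass γ.1)

/-- The space of homologically trivial vectors of untagged loops of length `L`. -/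
noncomputable def homologicallyTrivial (α : Type*) [Finite α] [DecidableEq α] (L : ℕ) :
    Submodule ℚ (Loop α L → ℚ) :=
  LinearMap.ker (homologyMap α L)

/-- A vector is integral if all its coordinates are integers. -/
def IsIntegralVector {α : Type*} {L : ℕ} (v : Loop α L → ℚ) : Prop :=
  ∀ γ, ∃ m : ℤ, v γ = (m : ℚ)

/-- The uniform vector, all of whose coordinates are `1`. -/
def uniformVector (α : Type*) (L : ℕ) : Loop α L → ℚ := fun _ => 1

/-- A finite fatgraph `Y` (without isolated vertices) together with a folded (locally injective) map
to the rose with petals `α`. `Dart` is the set of oriented edges, thought of as based at their initial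
vertices; `flip` reverses the orientation; the cycles of `next` are the vertices, and give the
cyclic order of the darts that leave each vertex. An oriented edge is mapped to the path in the rose
that its label spells, so that its length is the length of the label. The map is injective near the
interior points of the edges since the labels are reduced, and near a vertex since
different darts at the vertex have different first letters. -/
structure FoldedFatgraph (α : Type*) where
  Dart : Type
  [fintypeDart : Fintype Dart]
  [decidableEqDart : DecidableEq Dart]
  flip : Equiv.Perm Dart
  flip_flip : ∀ d, flip (flip d) = d
  flip_ne : ∀ d, flip d ≠ d
  next : Equiv.Perm Dart
  label : Dart → List (α × Bool)
  label_ne_nil : ∀ d, label d ≠ []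
  label_flip : ∀ d, label (flip d) = FreeGroup.invRev (label d)
  label_reduced : ∀ d, FreeGroup.IsReduced (label d)
  folded : ∀ d e, next.SameCycle d e → d ≠ e → (label d).head? ≠ (label e).head?

namespace FoldedFatgraph

attribute [instance] FoldedFatgraph.fintypeDart FoldedFatgraph.decidableEqDart

/-- The set of cycles (orbits, in their cyclic order) of a permutation of a finite set,
including those of length `1`. -/
noncomputable def cyclesOf {D : Type} [Fintype D] [DecidableEq D] (p : Equiv.Perm D) :
    Finset (Cycle D) :=
  Finset.univ.image (fun d => Function.periodicOrbit p d)

variable {α : Type*} (Y : FoldedFatgraph α)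

/-- The boundary of the fattening `S(Y)` runs along a dart `d` to its terminal vertex, where it turns
to the dart that follows the reverse of `d` in the cyclic order. -/
def face : Equiv.Perm Y.Dart := Y.flip.trans Y.next

/-- The boundary components of the fattening, each as the cycle of darts that it runs along. -/
noncomputable def boundaryComponents : Finset (Cycle Y.Dart) := cyclesOf Y.face

/-- The cyclic word spelled by a cycle of darts: the concatenation of their labels. -/
def cyclicWord (c : Cycle Y.Dart) : Cycle (α × Bool) :=
  Quotient.map (sa := List.IsRotated.setoid Y.Dart) (sb := List.IsRotated.setoid (α × Bool))
    (fun l : List Y.Dart => l.flatMap Y.label)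
    (by
      rintro l l' ⟨n, rfl⟩
      change (l.flatMap Y.label) ~r ((l.rotate n).flatMap Y.label)
      rw [← List.rotate_mod, List.rotate_eq_drop_append_take_mod]
      conv_lhs => rw [← List.take_append_drop (n % l.length) l]
      simp only [List.flatMap_append, Nat.mod_mod]
      exact List.isRotated_append) c

/-- The oriented boundary `∂S(Y)`, as the collection of the cyclic words spelled by the
boundary components. -/
noncomputable def boundary : Multiset (Cycle (α × Bool)) :=
  Y.boundaryComponents.val.map Y.cyclicWord

/-- The number of vertices minus the number of edges; the Euler characteristic of `Y` and of its
fattening. -/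
noncomputable def eulerCharacteristic : ℤ :=
  ((cyclesOf Y.next).card : ℤ) - ((cyclesOf Y.flip).card : ℤ)

/-- `Y` is nonempty and connected: any dart can be reached from any other one by
reversing darts and by turning around vertices. -/
def IsConnected : Prop :=
  Nonempty Y.Dart ∧
    ∀ d e : Y.Dart, Relation.ReflTransGen (fun x y => y = Y.flip x ∨ y = Y.next x) d e

/-- Exactly three darts leave every vertex. -/
def IsTrivalent : Prop := ∀ v ∈ cyclesOf Y.next, v.length = 3

/-- The fattening of `Y` is a pair of pants: the connected oriented surface with Euler
characteristic `-1` and three boundary components. -/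
def IsPants : Prop :=
  Y.IsConnected ∧ Y.eulerCharacteristic = -1 ∧ Y.boundaryComponents.card = 3

/-- The fattening of `Y` is an annulus: the connected oriented surface with Euler
characteristic `0` and two boundary components. -/
def IsAnnulus : Prop :=
  Y.IsConnected ∧ Y.eulerCharacteristic = 0 ∧ Y.boundaryComponents.card = 2

/-- A good (untagged) pair of pants: a trivalent pair of pants with boundary in the loops of
length `L`, all of whose edges have length exactly `L / 2`. -/
def IsGoodPants (L : ℕ) : Prop :=
  Y.IsPants ∧ Y.IsTrivalent ∧ (∀ d, 2 * (Y.label d).length = L) ∧ ∀ c ∈ Y.boundary, IsLoop L c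

/-- A good (untagged) annulus: a fatgraph annulus whose boundary is two loops of length `L`. -/
def IsGoodAnnulus (L : ℕ) : Prop :=
  Y.IsAnnulus ∧ ∀ c ∈ Y.boundary, IsLoop L c

end FoldedFatgraph

/-- The vector `w` bounds a (finite) collection of good pants and annuli: the boundary of the disjoint
union of the collection contains every loop `γ` exactly `w γ` times. -/
def BoundsGoodPantsAndAnnuli {α : Type*} [DecidableEq α] {L : ℕ} (w : Loop α L → ℚ) : Prop :=
  ∃ C : List (FoldedFatgraph α),
    (∀ Y ∈ C, Y.IsGoodPants L ∨ Y.IsGoodAnnulus L) ∧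
      ∀ γ : Loop α L, w γ = (((C.map FoldedFatgraph.boundary).sum.count γ.1 : ℕ) : ℚ)

/-! Put m = L/2 and call an integral vector bounding if it becomes the boundary of a collection
after adding some n𝟏', n ≥ 0. The annuli with boundary γ + γ⁻¹, taken over all loops γ, add up to
2·𝟏', so the negative of an annulus vector is bounding. Pants with the opposite orientation,
corrected by such negatives, show the same for pants. Hence all these vectors lie in the group
`boundingSubgroup`, and the class ψ(γ) of a loop in the quotient is a boundary cocycle: it is odd
under reversal of γ and ψ(xy⁻¹) + ψ(yz⁻¹) + ψ(zx⁻¹) = 0 for the edge words x, y, z of a good theta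
graph.

It remains to see that such a ψ depends linearly on homology. The pants relation says that ψ(xy⁻¹)
is a cocycle on the graph of words of length m, where edges join words that differ in both the
initial and the terminal letter. Triangles fill all closed paths of this graph, so ψ(xy⁻¹) = f(x) -
f(y) (`exists_potential`). Two ways to halve one loop, with cuts one letter apart, give f(pu) -
f(uq) = h(p) - h(q) for letters p, q (`exists_letter_potential`). Sliding a window of length m along
a long word then shows that f is the sum of h over the letters, up to a constant. So ψ counts
letters (`exists_eq_sum`), and as the length is fixed it sees only exponent sums. -/

/-! ### Cocycles on the grid of initial and terminal letters -/

/-- `w` is a common neighbour of `x` and `x'` whose letters are not mutually inverse. -/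
def IsAdmissibleNeighbour (x x' w : (Fin 2 × Bool) × (Fin 2 × Bool)) : Prop :=
  w.1 ≠ x.1 ∧ w.1 ≠ x'.1 ∧ w.2 ≠ x.2 ∧ w.2 ≠ x'.2 ∧ w.2 ≠ (w.1.1, !w.1.2)

instance (x x' w : (Fin 2 × Bool) × (Fin 2 × Bool)) : Decidable (IsAdmissibleNeighbour x x' w) :=
  inferInstanceAs (Decidable (_ ∧ _))

/-- Two common neighbours `z`, `z'` of `x`, `x'` are joined by a path of admissible neighbours. -/
def IsLinked (x x' z z' : (Fin 2 × Bool) × (Fin 2 × Bool)) : Prop :=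
  ∃ w₁, (w₁.1 ≠ z.1 ∧ w₁.2 ≠ z.2 ∧ IsAdmissibleNeighbour x x' w₁) ∧
    ∃ w₂, (w₂.1 ≠ z'.1 ∧ w₂.2 ≠ z'.2 ∧ IsAdmissibleNeighbour x x' w₂) ∧
      ∃ w, (w = w₁ ∨ w.1 ≠ w₁.1 ∧ w.2 ≠ w₁.2) ∧ (w = w₂ ∨ w.1 ≠ w₂.1 ∧ w.2 ≠ w₂.2) ∧
        IsAdmissibleNeighbour x x' w

set_option synthInstance.maxSize 2000 in
instance (x x' z z' : (Fin 2 × Bool) × (Fin 2 × Bool)) : Decidable (IsLinked x x' z z') :=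
  inferInstanceAs (Decidable (∃ _, _))

-- A finite check on the 4 × 4 grid. Together with the next lemma and the symmetry exchanging
-- coordinates it covers all positions of two nonadjacent pairs. Only the intermediate points must
-- be admissible, because only those have to be realised by new words.
set_option maxRecDepth 100000 in
set_option maxHeartbeats 4000000 in
theorem isLinked_row_row : ∀ i j j' r : Fin 2 × Bool, r ≠ i → ∀ c, c ≠ j → c ≠ j' →
    ∀ c' : Fin 2 × Bool, c' ≠ j → c' ≠ j' → IsLinked (i, j) (i, j') (r, c) (r, c') := by
  decide

set_option maxRecDepth 100000 in
set_option maxHeartbeats 4000000 in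
theorem isLinked_row_col : ∀ i j j' r : Fin 2 × Bool, r ≠ i → ∀ r', r' ≠ i → ∀ c, c ≠ j →
    c ≠ j' → IsLinked (i, j) (i, j') (r, c) (r', c) := by
  decide

theorem IsAdmissibleNeighbour.swap {x x' w : (Fin 2 × Bool) × (Fin 2 × Bool)}
    (h : IsAdmissibleNeighbour x x' w) : IsAdmissibleNeighbour x.swap x'.swap w.swap := by
  obtain ⟨h₁, h₂, h₃, h₄, h₅⟩ := h
  refine ⟨h₃, h₄, h₁, h₂, fun h => h₅ ?_⟩
  simp only [Prod.fst_swap, Prod.snd_swap] at h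
  simp [h]

theorem IsLinked.of_swap {x x' z z' : (Fin 2 × Bool) × (Fin 2 × Bool)}
    (h : IsLinked x.swap x'.swap z.swap z'.swap) : IsLinked x x' z z' := by
  obtain ⟨w₁, ⟨h₁, h₁', h₁''⟩, w₂, ⟨h₂, h₂', h₂''⟩, w, h₃, h₄, h⟩ := h
  refine ⟨w₁.swap, ⟨h₁', h₁, h₁''.swap⟩, w₂.swap, ⟨h₂', h₂, h₂''.swap⟩, w.swap, ?_, ?_, h.swap⟩
  · exact h₃.imp (congrArg _) And.symm
  · exact h₄.imp (congrArg _) And.symm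

/-- The link of a pair of points of the grid which are not adjacent is connected. -/
theorem isLinked_of_not_adj {x x' z z' : (Fin 2 × Bool) × (Fin 2 × Bool)}
    (hx : ¬ (x.1 ≠ x'.1 ∧ x.2 ≠ x'.2)) (hz : ¬ (z.1 ≠ z'.1 ∧ z.2 ≠ z'.2))
    (h₁ : z.1 ≠ x.1 ∧ z.2 ≠ x.2) (h₂ : z.1 ≠ x'.1 ∧ z.2 ≠ x'.2)
    (h₃ : z'.1 ≠ x.1 ∧ z'.2 ≠ x.2) (h₄ : z'.1 ≠ x'.1 ∧ z'.2 ≠ x'.2) : IsLinked x x' z z' := by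
  obtain ⟨i, j⟩ := x
  obtain ⟨i', j'⟩ := x'
  obtain ⟨r, c⟩ := z
  obtain ⟨r', c'⟩ := z'
  simp only [not_and_or, not_not] at *
  rcases hx with rfl | rfl <;> rcases hz with rfl | rfl
  · exact isLinked_row_row _ _ _ _ h₁.1 _ h₁.2 h₂.2 _ h₃.2 h₄.2
  · exact isLinked_row_col _ _ _ _ h₁.1 _ h₃.1 _ h₁.2 h₂.2
  · exact .of_swap (isLinked_row_col _ _ _ _ h₁.2 _ h₃.2 _ h₁.1 h₂.1)
  · exact .of_swap (isLinked_row_row _ _ _ _ h₁.2 _ h₁.1 h₂.1 _ h₃.1 h₄.1)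

theorem exists_ne_three : ∀ p q r : Fin 2 × Bool, ∃ t, t ≠ p ∧ t ≠ q ∧ t ≠ r := by
  decide

/-- Three points of the grid two of which are in one column have a common neighbour whose letters are
not mutually inverse. -/
theorem exists_common_neighbour (p p' p'' q q' : Fin 2 × Bool) :
    ∃ t s : Fin 2 × Bool, t ≠ p ∧ t ≠ p' ∧ t ≠ p'' ∧ s ≠ q ∧ s ≠ q' ∧ s ≠ (t.1, !t.2) := by
  obtain ⟨t, h⟩ := exists_ne_three p p' p''
  obtain ⟨s, h'⟩ := exists_ne_three q q' (t.1, !t.2)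
  exact ⟨t, s, h.1, h.2.1, h.2.2, h'⟩

/-- A cocycle on the graph whose vertices have an initial and a terminal letter and whose edges join
vertices that differ in both, is a coboundary. -/
theorem exists_potential {V A : Type*} [AddCommGroup A] (s t : V → Fin 2 × Bool)
    (hV : ∀ p q : Fin 2 × Bool, q ≠ (p.1, !p.2) → ∃ v, s v = p ∧ t v = q) (g : V → V → A)
    (anti : ∀ x y, s x ≠ s y → t x ≠ t y → g y x = -g x y)
    (cocycle : ∀ x y z, s x ≠ s y → t x ≠ t y → s y ≠ s z → t y ≠ t z → s x ≠ s z → t x ≠ t z →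
      g x y + g y z = g x z) :
    ∃ f : V → A, ∀ x y, s x ≠ s y → t x ≠ t y → g x y = f x - f y := by
  let T : V → (Fin 2 × Bool) × (Fin 2 × Bool) := fun v => (s v, t v)
  let Adj : V → V → Prop := fun x y => s x ≠ s y ∧ t x ≠ t y
  have symm : ∀ {x y}, Adj x y → Adj y x := fun h => ⟨h.1.symm, h.2.symm⟩
  have anti' : ∀ {x y}, Adj x y → g y x = -g x y := fun h => anti _ _ h.1 h.2
  have cocycle' : ∀ {x y z}, Adj x y → Adj y z → Adj x z → g x y + g y z = g x z :=
    fun h h' h'' => cocycle _ _ _ h.1 h.2 h'.1 h'.2 h''.1 h''.2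
  -- The diagonal from z to z' cuts the square x z x' z' into two triangles.
  have step : ∀ {x x' z z'}, Adj z x → Adj z x' → Adj z' x → Adj z' x' → (z = z' ∨ Adj z z') →
      g x z + g z x' = g x z' + g z' x' := by
    intro x x' z z' h₁ h₂ h₃ h₄ h
    rcases h with rfl | h
    · rfl
    · rw [← cocycle' h h₄ h₂, ← cocycle' (symm h₁) h (symm h₃), add_assoc]
  have indep : ∀ {x x' z z'}, Adj z x → Adj z x' → Adj z' x → Adj z' x' →
      g x z + g z x' = g x z' + g z' x' := by
    intro x x' z z' h₁ h₂ h₃ h₄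
    by_cases hx : Adj x x'
    · rw [cocycle' (symm h₁) h₂ hx, cocycle' (symm h₃) h₄ hx]
    by_cases hz : Adj z z'
    · exact step h₁ h₂ h₃ h₄ (Or.inr hz)
    obtain ⟨w₁, ⟨a₁, b₁, c₁⟩, w₂, ⟨a₂, b₂, c₂⟩, w, e₁, e₂, c⟩ :=
      isLinked_of_not_adj (x := T x) (x' := T x') (z := T z) (z' := T z') hx hz h₁ h₂ h₃ h₄
    have lift : ∀ w : (Fin 2 × Bool) × (Fin 2 × Bool), IsAdmissibleNeighbour (T x) (T x') w →
        ∃ v, T v = w ∧ Adj v x ∧ Adj v x' := by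
      intro w hw
      obtain ⟨v, hs, ht⟩ := hV w.1 w.2 hw.2.2.2.2
      have hv : T v = w := Prod.ext hs ht
      subst hv
      exact ⟨v, rfl, ⟨hw.1, hw.2.2.1⟩, hw.2.1, hw.2.2.2.1⟩
    obtain ⟨v, rfl, d, d'⟩ := lift w c
    have lift' : ∀ w', IsAdmissibleNeighbour (T x) (T x') w' →
        (T v = w' ∨ (T v).1 ≠ w'.1 ∧ (T v).2 ≠ w'.2) →
        ∃ v', T v' = w' ∧ Adj v' x ∧ Adj v' x' ∧ (v = v' ∨ Adj v v') := by
      rintro w' hw (rfl | h)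
      · exact ⟨v, rfl, d, d', Or.inl rfl⟩
      · obtain ⟨v', rfl, h', h''⟩ := lift w' hw
        exact ⟨v', rfl, h', h'', Or.inr h⟩
    obtain ⟨v₁, rfl, d₁, d₁', f₁⟩ := lift' w₁ c₁ e₁
    obtain ⟨v₂, rfl, d₂, d₂', f₂⟩ := lift' w₂ c₂ e₂
    -- The midpoint moves along the path z, v₁, v, v₂, z' in the common link of x and x'.
    rw [step h₁ h₂ d₁ d₁' (Or.inr (symm ⟨a₁, b₁⟩)), ← step d d' d₁ d₁' f₁, step d d' d₂ d₂' f₂,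
      step d₂ d₂' h₃ h₄ (Or.inr ⟨a₂, b₂⟩)]
  have common : ∀ x y z, (s x = s y ∨ s y = s z ∨ s x = s z ∨ t x = t y ∨ t y = t z ∨ t x = t z) →
      ∃ w, Adj w x ∧ Adj w y ∧ Adj w z := by
    intro x y z h
    suffices H : ∃ p q : Fin 2 × Bool, p ≠ s x ∧ p ≠ s y ∧ p ≠ s z ∧ q ≠ t x ∧ q ≠ t y ∧ q ≠ t z ∧
        q ≠ (p.1, !p.2) by
      obtain ⟨p, q, h₁, h₂, h₃, h₄, h₅, h₆, h⟩ := H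
      obtain ⟨w, rfl, rfl⟩ := hV p q h
      exact ⟨w, ⟨h₁, h₄⟩, ⟨h₂, h₅⟩, h₃, h₆⟩
    rcases h with h | h | h | h | h | h
    · obtain ⟨q, p, h₁, h₂, h₃, h₄, h₅, h₆⟩ := exists_common_neighbour (t x) (t y) (t z) (s y) (s z)
      exact ⟨p, q, h ▸ h₄, h₄, h₅, h₁, h₂, h₃, fun e => h₆ (by rw [e]; simp)⟩
    · obtain ⟨q, p, h₁, h₂, h₃, h₄, h₅, h₆⟩ := exists_common_neighbour (t x) (t y) (t z) (s x) (s z)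
      exact ⟨p, q, h₄, h ▸ h₅, h₅, h₁, h₂, h₃, fun e => h₆ (by rw [e]; simp)⟩
    · obtain ⟨q, p, h₁, h₂, h₃, h₄, h₅, h₆⟩ := exists_common_neighbour (t x) (t y) (t z) (s y) (s z)
      exact ⟨p, q, h ▸ h₅, h₄, h₅, h₁, h₂, h₃, fun e => h₆ (by rw [e]; simp)⟩
    · obtain ⟨p, q, h₁, h₂, h₃, h₄, h₅, h₆⟩ := exists_common_neighbour (s x) (s y) (s z) (t y) (t z)
      exact ⟨p, q, h₁, h₂, h₃, h ▸ h₄, h₄, h₅, h₆⟩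
    · obtain ⟨p, q, h₁, h₂, h₃, h₄, h₅, h₆⟩ := exists_common_neighbour (s x) (s y) (s z) (t x) (t z)
      exact ⟨p, q, h₁, h₂, h₃, h₄, h ▸ h₅, h₅, h₆⟩
    · obtain ⟨p, q, h₁, h₂, h₃, h₄, h₅, h₆⟩ := exists_common_neighbour (s x) (s y) (s z) (t y) (t z)
      exact ⟨p, q, h₁, h₂, h₃, h ▸ h₅, h₄, h₅, h₆⟩
  obtain ⟨o, -, -⟩ := hV (0, true) (0, true) (by decide)
  -- Repeating x makes two of the three vertices share a letter, so a path of length two from x to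
  -- the base point exists.
  choose n hn using fun x => common x x o (Or.inl rfl)
  refine ⟨fun x => g x (n x) + g (n x) o, fun x y hs ht => ?_⟩
  beta_reduce
  have hxy : Adj x y := ⟨hs, ht⟩
  -- Either x, y, o have a common neighbour through which both paths can be rerouted, or they
  -- already form a triangle.
  by_cases h : s x = s y ∨ s y = s o ∨ s x = s o ∨ t x = t y ∨ t y = t o ∨ t x = t o
  · obtain ⟨w, h₁, h₂, h₃⟩ := common x y o h
    rw [indep (hn x).1 (hn x).2.2 h₁ h₃, indep (hn y).1 (hn y).2.2 h₂ h₃,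
      ← cocycle' (symm h₁) h₂ hxy, anti' h₂]
    abel
  · push Not at h
    have h₁ : Adj x o := ⟨h.2.2.1, h.2.2.2.2.2⟩
    have h₂ : Adj y o := ⟨h.2.1, h.2.2.2.2.1⟩
    rw [cocycle' (symm (hn x).1) (hn x).2.2 h₁, cocycle' (symm (hn y).1) (hn y).2.2 h₂,
      ← cocycle' hxy h₂ h₁]
    abel

/-! ### Reduced words and words that are apart -/

theorem not_cancel_iff : ∀ {a b : Fin 2 × Bool}, (a.1 = b.1 → a.2 = b.2) ↔ b ≠ (a.1, !a.2) := by
  decide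

theorem isReduced_append_iff {α : Type*} {x y : List (α × Bool)} :
    FreeGroup.IsReduced (x ++ y) ↔ FreeGroup.IsReduced x ∧ FreeGroup.IsReduced y ∧
      ∀ a ∈ x.getLast?, ∀ b ∈ y.head?, a.1 = b.1 → a.2 = b.2 :=
  List.isChain_append

theorem head?_invRev {α : Type*} (x : List (α × Bool)) :
    (FreeGroup.invRev x).head? = x.getLast?.map fun a => (a.1, !a.2) := by
  simp [FreeGroup.invRev]

theorem getLast?_invRev {α : Type*} (x : List (α × Bool)) :
    (FreeGroup.invRev x).getLast? = x.head?.map fun a => (a.1, !a.2) := by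
  simp [FreeGroup.invRev]

theorem FreeGroup.IsReduced.invRev {α : Type*} {x : List (α × Bool)} (h : FreeGroup.IsReduced x) :
    FreeGroup.IsReduced (FreeGroup.invRev x) := by
  unfold FreeGroup.IsReduced FreeGroup.invRev
  rw [List.isChain_reverse, List.isChain_map]
  exact List.IsChain.imp (fun a b hab e => by simpa using (hab e.symm).symm) h

theorem isReduced_replicate {α : Type*} (n : ℕ) (p : α × Bool) :
    FreeGroup.IsReduced (List.replicate n p) :=
  List.isChain_replicate_of_rel _ fun _ => rfl

/-- Two words with different initial and different terminal letters. -/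
def Apart (x y : List (Fin 2 × Bool)) : Prop := x.head? ≠ y.head? ∧ x.getLast? ≠ y.getLast?

theorem Apart.symm {x y : List (Fin 2 × Bool)} (h : Apart x y) : Apart y x := ⟨h.1.symm, h.2.symm⟩

theorem involutive_inverse {α : Type*} : Function.Involutive fun a : α × Bool => (a.1, !a.2) :=
  fun a => by simp

theorem Apart.invRev {x y : List (Fin 2 × Bool)} (h : Apart x y) :
    Apart (FreeGroup.invRev x) (FreeGroup.invRev y) := by
  unfold Apart
  rw [head?_invRev, head?_invRev, getLast?_invRev, getLast?_invRev]
  exact ⟨fun e => h.2 (Option.map_injective involutive_inverse.injective e),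
    fun e => h.1 (Option.map_injective involutive_inverse.injective e)⟩

/-- Cancellation at the middle of x y⁻¹ would need equal terminal letters, and cancellation at the
cyclic junction equal initial letters. -/
theorem Apart.isCyclicallyReduced {x y : List (Fin 2 × Bool)} (h : Apart x y)
    (hx : FreeGroup.IsReduced x) (hy : FreeGroup.IsReduced y) (hx₀ : x ≠ []) (hy₀ : y ≠ []) :
    FreeGroup.IsCyclicallyReduced (x ++ FreeGroup.invRev y) := by
  rw [FreeGroup.isCyclicallyReduced_iff, isReduced_append_iff]
  obtain ⟨a, x', rfl⟩ := List.exists_cons_of_ne_nil hx₀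
  obtain ⟨b, y', rfl⟩ := List.exists_cons_of_ne_nil hy₀
  refine ⟨⟨hx, hy.invRev, ?_⟩, ?_⟩
  · rw [head?_invRev]
    rintro c hc d hd
    rw [not_cancel_iff]
    rintro rfl
    obtain ⟨d, hd', e⟩ := Option.mem_map.1 hd
    have := involutive_inverse.injective (a₁ := d) (a₂ := c) e
    subst this
    exact h.2 (hc.trans hd'.symm)
  · rw [List.getLast?_append, getLast?_invRev]
    intro c hc d hd
    simp only [List.head?_cons, Option.map_some, Option.some_or, Option.mem_def, Option.some.injEq,
      List.cons_append] at hc hd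
    subst hc hd
    rw [not_cancel_iff]
    intro e
    apply h.1
    simp [e]

/-- Take p t ⋯ t q with t inverse to neither p nor q. For m = 2 there is no room for t, whence the
condition on p and q. -/
theorem exists_word {m : ℕ} (hm : 2 ≤ m) {p q : Fin 2 × Bool} (h : q ≠ (p.1, !p.2)) :
    ∃ x, FreeGroup.IsReduced x ∧ x.length = m ∧ x.head? = some p ∧ x.getLast? = some q := by
  obtain ⟨t, ht, ht', -⟩ := exists_ne_three (p.1, !p.2) (q.1, !q.2) p
  refine ⟨p :: (List.replicate (m - 2) t ++ [q]), ?_, by simp; omega, rfl, by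
    rw [← List.cons_append, List.getLast?_concat]⟩
  have h₁ : q ≠ (t.1, !t.2) := by
    rintro rfl
    simp at ht'
  obtain ⟨n, rfl⟩ := Nat.exists_eq_add_of_le' hm
  cases n with
  | zero => simpa [FreeGroup.IsReduced, not_cancel_iff] using h
  | succ n =>
    rw [← List.singleton_append, isReduced_append_iff, isReduced_append_iff]
    refine ⟨.singleton, ⟨isReduced_replicate _ _, .singleton, ?_⟩, ?_⟩
    · simpa [List.getLast?_replicate, not_cancel_iff] using h₁
    · simpa [List.replicate_succ, not_cancel_iff] using ht

theorem exists_apart {m : ℕ} (hm : 2 ≤ m) {x y : List (Fin 2 × Bool)} (hx : x ≠ []) (hy : y ≠ []) :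
    ∃ z, FreeGroup.IsReduced z ∧ z.length = m ∧ Apart x z ∧ Apart y z := by
  obtain ⟨t, s, h₁, h₂, -, h₃, h₄, h⟩ := exists_common_neighbour (x.head hx) (y.head hy) (y.head hy)
    (x.getLast hx) (y.getLast hy)
  obtain ⟨z, hz, hz', ht, hs⟩ := exists_word hm h
  refine ⟨z, hz, hz', ⟨?_, ?_⟩, ?_, ?_⟩
  · rw [ht, List.head?_eq_some_head hx]; simpa using h₁.symm
  · rw [hs, List.getLast?_eq_some_getLast hx]; simpa using h₃.symm
  · rw [ht, List.head?_eq_some_head hy]; simpa using h₂.symm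
  · rw [hs, List.getLast?_eq_some_getLast hy]; simpa using h₄.symm

/-! ### Boundary cocycles: potentials of half-loops -/

/-- A function on loops which vanishes on the boundaries of annuli and of pairs of pants. -/
structure IsBoundaryCocycle {A : Type*} [AddCommGroup A] (m : ℕ) (ψ : List (Fin 2 × Bool) → A) :
    Prop where
  rotate : ∀ x y, ψ (x ++ y) = ψ (y ++ x)
  invRev : ∀ l, FreeGroup.IsCyclicallyReduced l → l.length = 2 * m →
    ψ (FreeGroup.invRev l) = -ψ l
  pants : ∀ x y z, FreeGroup.IsReduced x → FreeGroup.IsReduced y → FreeGroup.IsReduced z →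
    x.length = m → y.length = m → z.length = m → Apart x y → Apart y z → Apart z x →
    ψ (x ++ FreeGroup.invRev y) + ψ (y ++ FreeGroup.invRev z) + ψ (z ++ FreeGroup.invRev x) = 0

namespace IsBoundaryCocycle

variable {A : Type*} [AddCommGroup A] {m : ℕ} {ψ : List (Fin 2 × Bool) → A}

theorem exists_potential (hψ : IsBoundaryCocycle m ψ) (hm : 2 ≤ m) :
    ∃ f : List (Fin 2 × Bool) → A, ∀ x y, FreeGroup.IsReduced x → FreeGroup.IsReduced y →
      x.length = m → y.length = m → Apart x y → ψ (x ++ FreeGroup.invRev y) = f x - f y := by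
  classical
  let V := {x : List (Fin 2 × Bool) // FreeGroup.IsReduced x ∧ x.length = m}
  let s : V → Fin 2 × Bool := fun v => v.1.head?.getD (0, true)
  let t : V → Fin 2 × Bool := fun v => v.1.getLast?.getD (0, true)
  have ne : ∀ v : V, v.1 ≠ [] := fun v h => by
    have := v.2.2
    rw [h, List.length_nil] at this
    omega
  have hs : ∀ v : V, v.1.head? = some (s v) := fun v => by
    simp only [s, List.head?_eq_some_head (ne v), Option.getD_some]
  have ht : ∀ v : V, v.1.getLast? = some (t v) := fun v => by
    simp only [t, List.getLast?_eq_some_getLast (ne v), Option.getD_some]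
  have apart : ∀ {x y : V}, s x ≠ s y → t x ≠ t y → Apart x.1 y.1 := fun {x y} h h' => by
    unfold Apart
    rw [hs, hs, ht, ht]
    exact ⟨fun e => h (Option.some.inj e), fun e => h' (Option.some.inj e)⟩
  have anti : ∀ x y : V, s x ≠ s y → t x ≠ t y →
      ψ (y.1 ++ FreeGroup.invRev x.1) = -ψ (x.1 ++ FreeGroup.invRev y.1) := by
    intro x y h h'
    rw [← hψ.invRev _ ((apart h h').isCyclicallyReduced x.2.1 y.2.1 (ne x) (ne y))
      (by simp [x.2.2, y.2.2, two_mul])]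
    simp
  have words : ∀ p q : Fin 2 × Bool, q ≠ (p.1, !p.2) → ∃ v, s v = p ∧ t v = q := by
    intro p q h
    obtain ⟨x, hx, hxm, h₁, h₂⟩ := exists_word hm h
    exact ⟨⟨x, hx, hxm⟩, by simp [s, h₁], by simp [t, h₂]⟩
  have cocycle : ∀ x y z : V, s x ≠ s y → t x ≠ t y → s y ≠ s z → t y ≠ t z → s x ≠ s z →
      t x ≠ t z → ψ (x.1 ++ FreeGroup.invRev y.1) + ψ (y.1 ++ FreeGroup.invRev z.1) =
        ψ (x.1 ++ FreeGroup.invRev z.1) := by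
    intro x y z h₁ h₂ h₃ h₄ h₅ h₆
    have := hψ.pants x.1 y.1 z.1 x.2.1 y.2.1 z.2.1 x.2.2 y.2.2 z.2.2 (apart h₁ h₂) (apart h₃ h₄)
      (apart h₅ h₆).symm
    rw [anti x z h₅ h₆] at this
    exact add_neg_eq_zero.1 this
  obtain ⟨f, hf⟩ := _root_.exists_potential s t words (fun x y => ψ (x.1 ++ FreeGroup.invRev y.1)) anti
    cocycle
  refine ⟨fun x => if h : FreeGroup.IsReduced x ∧ x.length = m then f ⟨x, h⟩ else 0, ?_⟩
  intro x y hx hy hxm hym h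
  simp only [dif_pos (And.intro hx hxm), dif_pos (And.intro hy hym)]
  refine hf ⟨x, hx, hxm⟩ ⟨y, hy, hym⟩ (fun e => h.1 ?_) (fun e => h.2 ?_)
  · exact (hs ⟨x, hx, hxm⟩).trans (e ▸ (hs ⟨y, hy, hym⟩).symm)
  · exact (ht ⟨x, hx, hxm⟩).trans (e ▸ (ht ⟨y, hy, hym⟩).symm)

/-- Up to a constant, the value on a loop is the sum of the potentials of its two halves. -/
theorem exists_half_potential (hψ : IsBoundaryCocycle m ψ) (hm : 2 ≤ m) :
    ∃ (f : List (Fin 2 × Bool) → A) (c : A),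
      (∀ x, FreeGroup.IsReduced x → x.length = m → f x + f (FreeGroup.invRev x) = c) ∧
      ∀ x y, FreeGroup.IsCyclicallyReduced (x ++ y) → x.length = m → y.length = m →
        ψ (x ++ y) = f x + f y - c := by
  obtain ⟨f, hf⟩ := hψ.exists_potential hm
  have key : ∀ x y, FreeGroup.IsReduced x → FreeGroup.IsReduced y → x.length = m → y.length = m →
      Apart x y → f x + f (FreeGroup.invRev x) = f y + f (FreeGroup.invRev y) := by
    intro x y hx hy hxm hym h
    have h₁ := hf x y hx hy hxm hym h
    -- The words y⁻¹x and xy⁻¹ are the same loop, read as two different differences of potentials.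
    have h₂ := hf _ _ hy.invRev hx.invRev (by simpa) (by simpa) h.symm.invRev
    rw [FreeGroup.invRev_invRev, hψ.rotate, h₁] at h₂
    have := sub_eq_sub_iff_add_eq_add.1 h₂
    rw [this, add_comm]
  have ne : ∀ {x : List (Fin 2 × Bool)}, x.length = m → x ≠ [] := by
    rintro x h rfl
    rw [List.length_nil] at h
    omega
  obtain ⟨o, ho, hom, -⟩ := exists_word hm (p := (0, true)) (q := (0, true)) (by decide)
  have const : ∀ x, FreeGroup.IsReduced x → x.length = m →
      f x + f (FreeGroup.invRev x) = f o + f (FreeGroup.invRev o) := by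
    intro x hx hxm
    obtain ⟨z, hz, hzm, h₁, h₂⟩ := exists_apart hm (ne hxm) (ne hom)
    rw [key x z hx hz hxm hzm h₁, key o z ho hz hom hzm h₂]
  refine ⟨f, _, const, fun x y h hxm hym => ?_⟩
  rw [FreeGroup.isCyclicallyReduced_iff, isReduced_append_iff] at h
  obtain ⟨⟨hx, hy, h⟩, h'⟩ := h
  have hap : Apart x (FreeGroup.invRev y) := by
    unfold Apart
    rw [head?_invRev, getLast?_invRev]
    rw [List.getLast?_append, List.head?_append] at h'
    rw [List.getLast?_eq_some_getLast (ne hxm), List.getLast?_eq_some_getLast (ne hym),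
      List.head?_eq_some_head (ne hxm), List.head?_eq_some_head (ne hym)] at *
    simp only [Option.mem_def, Option.some.injEq, forall_eq', Option.some_or, Option.map_some,
      not_cancel_iff] at *
    refine ⟨fun e => h' (Option.some.inj e), fun e => h ?_⟩
    rw [Option.some.inj e]
    simp
  have := hf x (FreeGroup.invRev y) hx hy.invRev hxm (by simpa) hap
  rw [FreeGroup.invRev_invRev] at this
  rw [this, ← const y hy hym]
  abel

end IsBoundaryCocycle

/-! ### Shifting the cut by one letter -/

theorem cycle_chain_iff {α : Type*} (l : List (α × Bool)) :
    (l : Cycle (α × Bool)).Chain (fun x y => x.1 = y.1 → x.2 = y.2) ↔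
      FreeGroup.IsCyclicallyReduced l := by
  rw [FreeGroup.isCyclicallyReduced_iff]
  cases l with
  | nil => simp
  | cons a l =>
    rw [Cycle.chain_coe_cons, ← List.cons_append]
    refine isReduced_append_iff.trans ?_
    simp

theorem isCyclicallyReduced_append_comm {α : Type*} {x y : List (α × Bool)} :
    FreeGroup.IsCyclicallyReduced (x ++ y) ↔ FreeGroup.IsCyclicallyReduced (y ++ x) := by
  rw [← cycle_chain_iff, ← cycle_chain_iff, Cycle.coe_eq_coe.2 List.isRotated_append]

/-- `p u` and `u q` are reduced words of length `m`. -/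
def Shiftable (m : ℕ) (p : Fin 2 × Bool) (u : List (Fin 2 × Bool)) (q : Fin 2 × Bool) : Prop :=
  FreeGroup.IsReduced (p :: (u ++ [q])) ∧ u.length + 1 = m

theorem shiftable_replicate {m : ℕ} (hm : 2 ≤ m) {p q t : Fin 2 × Bool} (hp : t ≠ (p.1, !p.2))
    (hq : t ≠ (q.1, !q.2)) : Shiftable m p (List.replicate (m - 1) t) q := by
  have h₁ : q ≠ (t.1, !t.2) := by
    rintro rfl
    simp at hq
  obtain ⟨n, rfl⟩ := Nat.exists_eq_add_of_le' hm
  refine ⟨?_, by simp⟩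
  rw [← List.singleton_append, isReduced_append_iff, isReduced_append_iff]
  refine ⟨.singleton, ⟨isReduced_replicate _ _, .singleton, ?_⟩, ?_⟩
  · simpa [List.getLast?_replicate, not_cancel_iff] using h₁
  · simpa [List.replicate_succ, not_cancel_iff] using hp

theorem exists_shiftable {m : ℕ} (hm : 2 ≤ m) (p q : Fin 2 × Bool) : ∃ u, Shiftable m p u q := by
  obtain ⟨t, h₁, h₂, -⟩ := exists_ne_three (p.1, !p.2) (q.1, !q.2) p
  exact ⟨_, shiftable_replicate hm h₁ h₂⟩

namespace IsBoundaryCocycle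

variable {A : Type*} [AddCommGroup A] {m : ℕ} {ψ : List (Fin 2 × Bool) → A}

/-- The loop p u q v can be halved as pu | qv or, one letter later, as uq | vp. Both halvings
compute the same value of ψ. -/
theorem shift_eq_neg (hψ : IsBoundaryCocycle m ψ) {f : List (Fin 2 × Bool) → A} {c : A}
    (hf : ∀ x y, FreeGroup.IsCyclicallyReduced (x ++ y) → x.length = m → y.length = m →
      ψ (x ++ y) = f x + f y - c) {p q : Fin 2 × Bool} {u v : List (Fin 2 × Bool)}
    (hu : Shiftable m p u q) (hv : Shiftable m q v p) :
    f (p :: u) - f (u ++ [q]) = -(f (q :: v) - f (v ++ [p])) := by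
  have h : FreeGroup.IsCyclicallyReduced ((p :: u) ++ (q :: v)) := by
    rw [FreeGroup.isCyclicallyReduced_iff]
    have h₁ : FreeGroup.IsReduced ((p :: u) ++ [q]) := hu.1
    have h₂ : FreeGroup.IsReduced ((q :: v) ++ [p]) := hv.1
    have h₃ := isReduced_append_iff.1 h₂
    refine ⟨?_, ?_⟩
    · simpa using h₁.append_overlap (L₃ := v) h₃.1 (by simp)
    · rw [List.getLast?_append_of_ne_nil _ (by simp)]
      intro a ha b hb
      exact h₃.2.2 a ha b (by simpa using hb)
  have h' : FreeGroup.IsCyclicallyReduced ((u ++ [q]) ++ (v ++ [p])) := by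
    have : (u ++ [q]) ++ (v ++ [p]) = (u ++ q :: v) ++ [p] := by simp
    rw [this, isCyclicallyReduced_append_comm]
    simpa using h
  have e := hf _ _ h (by simpa using hu.2) (by simpa using hv.2)
  have e' := hf _ _ h' (by simpa using hu.2) (by simpa using hv.2)
  have : (u ++ [q]) ++ (v ++ [p]) = (u ++ q :: v) ++ [p] := by simp
  rw [this, hψ.rotate, List.singleton_append, ← List.cons_append, e] at e'
  have e'' := sub_left_injective e'
  rw [neg_sub]
  exact sub_eq_sub_iff_add_eq_add.2 (e''.trans (add_comm _ _))

/-- The effect of a shift on the potential is additive in the letters. -/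
theorem exists_letter_potential (hψ : IsBoundaryCocycle m ψ) (hm : 2 ≤ m)
    {f : List (Fin 2 × Bool) → A} {c : A}
    (hf : ∀ x y, FreeGroup.IsCyclicallyReduced (x ++ y) → x.length = m → y.length = m →
      ψ (x ++ y) = f x + f y - c) :
    ∃ h : Fin 2 × Bool → A, ∀ p u q, Shiftable m p u q →
      f (p :: u) - f (u ++ [q]) = h p - h q := by
  have neg : ∀ {p q u v}, Shiftable m p u q → Shiftable m q v p →
      f (p :: u) - f (u ++ [q]) = -(f (q :: v) - f (v ++ [p])) :=
    fun hu hv => hψ.shift_eq_neg hf hu hv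
  have indep : ∀ {p q u v}, Shiftable m p u q → Shiftable m p v q →
      f (p :: u) - f (u ++ [q]) = f (p :: v) - f (v ++ [q]) := by
    intro p q u v hu hv
    obtain ⟨w, hw⟩ := exists_shiftable hm q p
    rw [neg hu hw, neg hv hw]
  have self : ∀ {p u}, Shiftable m p u p → f (p :: u) - f (u ++ [p]) = 0 := by
    intro p u hu
    -- By independence of u one may take u = p ⋯ p, and then pu = up.
    have hp : p ≠ (p.1, !p.2) := fun h => by simpa using congrArg Prod.snd h
    rw [indep hu (shiftable_replicate hm hp hp), ← List.replicate_succ, ← List.replicate_succ',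
      sub_self]
  have cycle : ∀ {p q r u v w}, Shiftable m p u q → Shiftable m q v r → Shiftable m r w p →
      (f (p :: u) - f (u ++ [q])) + (f (q :: v) - f (v ++ [r])) +
        (f (r :: w) - f (w ++ [p])) = 0 := by
    intro p q r u v w hu hv hw
    -- With the same filler t ⋯ t in all three shifts, the vanishing of the shifts from a letter to
    -- itself makes the sum telescope.
    obtain ⟨t, hp, hq, hr⟩ := exists_ne_three (p.1, !p.2) (q.1, !q.2) (r.1, !r.2)
    rw [indep hu (shiftable_replicate hm hp hq), indep hv (shiftable_replicate hm hq hr),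
      indep hw (shiftable_replicate hm hr hp)]
    have e₁ := self (shiftable_replicate hm hp hp)
    have e₂ := self (shiftable_replicate hm hq hq)
    have e₃ := self (shiftable_replicate hm hr hr)
    rw [sub_eq_zero] at e₁ e₂ e₃
    rw [e₁, e₂, e₃]
    abel
  choose u hu using fun p => exists_shiftable hm p (0, true)
  choose v hv using fun p => exists_shiftable hm (0, true) p
  refine ⟨fun p => f (p :: u p) - f (u p ++ [(0, true)]), fun p w q hw => ?_⟩
  have e := cycle hw (hu q) (hv p)
  rw [neg (hv p) (hu p), ← sub_eq_add_neg, sub_eq_zero] at e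
  exact eq_sub_of_add_eq e

/-- The value on a loop is determined by the number of occurrences of the letters. -/
theorem exists_eq_sum (hψ : IsBoundaryCocycle m ψ) (hm : 2 ≤ m) :
    ∃ (h : Fin 2 × Bool → A) (e : A), (∀ p, h p + h (p.1, !p.2) = e) ∧
      ∀ l, FreeGroup.IsCyclicallyReduced l → l.length = 2 * m →
        ψ l = (l.map h).sum - m • e := by
  obtain ⟨f, c, hc, hf⟩ := hψ.exists_half_potential hm
  obtain ⟨h, hh⟩ := hψ.exists_letter_potential hm hf
  let F : List (Fin 2 × Bool) → A := fun x => f x - (x.map h).sum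
  -- F is unchanged when the window of length m slides along a reduced word.
  have shift : ∀ z x, FreeGroup.IsReduced (x ++ z) → x.length = m →
      F x = F ((x ++ z).drop z.length) := by
    intro z
    induction z with
    | nil => simp
    | cons q z ih =>
      intro x hx hxm
      cases x with
      | nil =>
        rw [List.length_nil] at hxm
        omega
      | cons p u =>
        have e : (p :: u) ++ q :: z = p :: ((u ++ [q]) ++ z) := by simp
        rw [e] at hx ⊢
        rw [List.length_cons, List.drop_succ_cons,
          ← ih (u ++ [q]) (hx.infix ⟨[p], [], by simp⟩) (by simpa using hxm)]
        have := hh p u q ⟨hx.infix ⟨[], z, by simp⟩, by simpa using hxm⟩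
        simp only [F, List.map_cons, List.sum_cons, List.map_append, List.sum_append, List.map_nil,
          List.sum_nil, add_zero]
        rw [sub_eq_iff_eq_add.1 this]
        abel
  have ne : ∀ {x : List (Fin 2 × Bool)}, x.length = m → x ≠ [] := by
    rintro x h rfl
    rw [List.length_nil] at h
    omega
  have const : ∀ x y, FreeGroup.IsReduced x → FreeGroup.IsReduced y → x.length = m →
      y.length = m → F x = F y := by
    intro x y hx hy hxm hym
    -- The letter t makes x t y reduced, so the window can slide from x to y.
    obtain ⟨t, h₁, h₂, -⟩ := exists_ne_three ((x.getLast (ne hxm)).1, !(x.getLast (ne hxm)).2)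
      ((y.head (ne hym)).1, !(y.head (ne hym)).2) (0, true)
    have h₃ : y.head (ne hym) ≠ (t.1, !t.2) := fun e => h₂ (by simp [e])
    rw [shift (t :: y) x _ hxm]
    · have : x ++ t :: y = (x ++ [t]) ++ y := by simp
      rw [this, List.drop_left' (by simp [hxm, hym])]
    · rw [← List.singleton_append, isReduced_append_iff, isReduced_append_iff]
      refine ⟨hx, ⟨.singleton, hy, ?_⟩, ?_⟩
      · rw [List.head?_eq_some_head (ne hym)]
        simpa [not_cancel_iff] using h₃
      · rw [List.getLast?_eq_some_getLast (ne hxm)]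
        simpa [not_cancel_iff] using h₁
  obtain ⟨o, ho, hom, -⟩ := exists_word hm (p := (0, true)) (q := (0, true)) (by decide)
  have hF : ∀ x, FreeGroup.IsReduced x → x.length = m → f x = (x.map h).sum + F o := by
    intro x hx hxm
    rw [← const x o hx ho hxm hom]
    simp [F]
  have sum_inv : ∀ x : List (Fin 2 × Bool), (x.map h).sum + ((FreeGroup.invRev x).map h).sum =
      (x.map fun p => h p + h (p.1, !p.2)).sum := by
    intro x
    rw [List.sum_map_add, FreeGroup.invRev, List.map_reverse, List.sum_reverse, List.map_map]
    rfl
  have hc' : ∀ x, FreeGroup.IsReduced x → x.length = m →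
      (x.map fun p => h p + h (p.1, !p.2)).sum + (F o + F o) = c := by
    intro x hx hxm
    rw [← hc x hx hxm, hF x hx hxm, hF _ hx.invRev (by simpa), ← sum_inv]
    abel
  obtain ⟨n, rfl⟩ := Nat.exists_eq_add_of_le' hm
  have h₁ : ∀ p, (n + 2) • (h p + h (p.1, !p.2)) + (F o + F o) = c := by
    intro p
    rw [← hc' _ (isReduced_replicate (n + 2) p) (by simp)]
    simp
  have h₂ : ∀ p, h p + h (p.1, !p.2) = h (0, true) + h (0, false) := by
    intro p
    -- The comparison of a^m with a^(m-1) p needs the latter to be reduced, which fails exactly for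
    -- p = a⁻¹; there the claim is commutativity.
    by_cases hp : p = (0, false)
    · rw [hp, add_comm]
      rfl
    · have e := hc' (List.replicate (n + 1) (0, true) ++ [p]) ?_ (by simp)
      · rw [← h₁ (0, true)] at e
        simp only [List.map_append, List.map_replicate, List.sum_append, List.sum_replicate,
          List.map_cons, List.map_nil, List.sum_cons, List.sum_nil, add_zero] at e
        rw [succ_nsmul _ (n + 1)] at e
        exact add_left_cancel (add_right_cancel e)
      · rw [isReduced_append_iff]
        refine ⟨isReduced_replicate _ _, .singleton, ?_⟩
        simpa [List.getLast?_replicate, not_cancel_iff] using hp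
  refine ⟨h, h (0, true) + h (0, false), h₂, fun l hl hlm => ?_⟩
  have hl₁ : (l.take (n + 2)).length = n + 2 := by simp; omega
  have hl₂ : (l.drop (n + 2)).length = n + 2 := by simp; omega
  have e := List.take_append_drop (n + 2) l
  have e' := hf (l.take (n + 2)) (l.drop (n + 2)) (by rwa [e]) hl₁ hl₂
  have hred := isReduced_append_iff.1 (e.symm ▸ hl.isReduced)
  rw [hF _ hred.1 hl₁, hF _ hred.2.1 hl₂, e, ← h₁ (0, true)] at e'
  rw [e']
  conv_rhs => rw [← e]
  rw [List.map_append, List.sum_append]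
  simp only [Bool.not_true]
  abel

end IsBoundaryCocycle

/-! ### Model annuli and pants -/

theorem isLoop_coe_iff {α : Type*} {L : ℕ} {l : List (α × Bool)} :
    IsLoop L (l : Cycle (α × Bool)) ↔ l.length = L ∧ FreeGroup.IsCyclicallyReduced l := by
  rw [IsLoop, cycle_chain_iff, Cycle.length_coe]

theorem FreeGroup.IsCyclicallyReduced.invRev {α : Type*} {l : List (α × Bool)}
    (h : FreeGroup.IsCyclicallyReduced l) :
    FreeGroup.IsCyclicallyReduced (FreeGroup.invRev l) := by
  rw [FreeGroup.isCyclicallyReduced_iff] at h ⊢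
  refine ⟨h.1.invRev, ?_⟩
  rw [head?_invRev, getLast?_invRev]
  intro a ha b hb e
  obtain ⟨a', ha', rfl⟩ := Option.mem_map.1 ha
  obtain ⟨b', hb', rfl⟩ := Option.mem_map.1 hb
  exact congrArg (!·) (h.2 b' hb' a' ha' e.symm).symm

section PeriodicOrbit

open Function

variable {D : Type*} {f : D → D} {d : D}

theorem minimalPeriod_eq_two (h₁ : f d ≠ d) (h₂ : f (f d) = d) : minimalPeriod f d = 2 :=
  haveI : Fact (Nat.Prime 2) := ⟨Nat.prime_two⟩
  minimalPeriod_eq_prime h₂ h₁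

theorem minimalPeriod_eq_three (h₁ : f d ≠ d) (h₂ : f (f (f d)) = d) : minimalPeriod f d = 3 :=
  haveI : Fact (Nat.Prime 3) := ⟨Nat.prime_three⟩
  minimalPeriod_eq_prime h₂ h₁

theorem periodicOrbit_eq_one (h : f d = d) : periodicOrbit f d = [d] := by
  rw [periodicOrbit_def, minimalPeriod_eq_one_iff_isFixedPt.2 h]
  rfl

theorem periodicOrbit_eq_two (h₁ : f d ≠ d) (h₂ : f (f d) = d) : periodicOrbit f d = [d, f d] := by
  rw [periodicOrbit_def, minimalPeriod_eq_two h₁ h₂]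
  rfl

theorem periodicOrbit_eq_three (h₁ : f d ≠ d) (h₂ : f (f (f d)) = d) :
    periodicOrbit f d = [d, f d, f (f d)] := by
  rw [periodicOrbit_def, minimalPeriod_eq_three h₁ h₂]
  rfl

end PeriodicOrbit

namespace FoldedFatgraph

/-- Replaces minimal periods by explicit cycles, so that counts of vertices, edges and faces become
decidable. -/
theorem cyclesOf_congr {D : Type} [Fintype D] [DecidableEq D] {p : Equiv.Perm D} {c : D → Cycle D}
    (h : ∀ d, Function.periodicOrbit p d = c d) : cyclesOf p = Finset.univ.image c := by
  rw [cyclesOf, funext h]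

/-- The annulus whose core spells the word `l`, with a single vertex and a single edge. -/
def annulus {α : Type*} (l : List (α × Bool)) (h : FreeGroup.IsCyclicallyReduced l) (hl : l ≠ []) :
    FoldedFatgraph α where
  Dart := Bool
  flip := Equiv.boolNot
  flip_flip := by decide
  flip_ne := by decide
  next := Equiv.boolNot
  label b := if b then l else FreeGroup.invRev l
  label_ne_nil := by
    have : FreeGroup.invRev l ≠ [] := fun e => hl (by
      rw [← FreeGroup.invRev_invRev (L₁ := l), e, FreeGroup.invRev_empty])
    simp [hl, this]
  label_flip := by simp
  label_reduced := by simp [h.isReduced, h.isReduced.invRev]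
  folded := by
    have key : l.head? ≠ (FreeGroup.invRev l).head? := by
      intro e
      rw [head?_invRev, List.head?_eq_some_head hl, List.getLast?_eq_some_getLast hl] at e
      have e' := Option.some.inj e
      have := h.2 _ (List.getLast?_eq_some_getLast hl) _ (List.head?_eq_some_head hl)
        (by rw [e'])
      rw [e'] at this
      simp at this
    intro d e _ hde
    cases d <;> cases e <;> simp_all [eq_comm]

section Annulus

variable {α : Type*} {l : List (α × Bool)} {h : FreeGroup.IsCyclicallyReduced l} {hl : l ≠ []}

/-- `flip` and `next` are the same involution, so every dart is a face by itself. -/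
theorem boundaryComponents_annulus :
    (annulus l h hl).boundaryComponents = Finset.univ.image fun b : Bool => Cycle.ofList [b] :=
  cyclesOf_congr fun b => periodicOrbit_eq_one (Bool.not_not b)

theorem boundary_annulus :
    (annulus l h hl).boundary = {(l : Cycle (α × Bool)), ↑(FreeGroup.invRev l)} := by
  rw [boundary, boundaryComponents_annulus, Finset.image_val_of_injOn (by decide)]
  refine (Multiset.map_map (annulus l h hl).cyclicWord (fun b : Bool => Cycle.ofList [b]) _).trans ?_
  refine (Multiset.map_congr rfl fun b _ => congrArg Cycle.ofList (List.append_nil _)).trans ?_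
  rfl

theorem isGoodAnnulus_annulus : (annulus l h hl).IsGoodAnnulus l.length := by
  refine ⟨⟨⟨⟨true⟩, ?_⟩, ?_, ?_⟩, ?_⟩
  · intro d e
    rcases eq_or_ne d e with rfl | hde
    · exact .refl
    · exact .single (Or.inl (Bool.eq_not_of_ne hde.symm))
  · exact sub_self _
  · rw [boundaryComponents_annulus]
    change (Finset.univ.image fun b : Bool => Cycle.ofList [b]).card = 2
    decide
  · rw [boundary_annulus]
    intro c hc
    rcases Multiset.mem_cons.1 hc with rfl | hc
    · exact isLoop_coe_iff.2 ⟨rfl, h⟩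
    · rw [Multiset.mem_singleton.1 hc]
      exact isLoop_coe_iff.2 ⟨FreeGroup.invRev_length, h.invRev⟩

end Annulus

/-- The cyclic orders at the two vertices of a planar theta graph are opposite to each other. -/
def thetaNext : Equiv.Perm (Fin 3 × Bool) where
  toFun d := (if d.2 then d.1 + 1 else d.1 - 1, d.2)
  invFun d := (if d.2 then d.1 - 1 else d.1 + 1, d.2)
  left_inv := by decide
  right_inv := by decide

/-- The reversal of the edges of a theta graph. -/
def thetaFlip : Equiv.Perm (Fin 3 × Bool) := (Equiv.refl _).prodCongr Equiv.boolNot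

/-- The theta graph whose edges spell the words `w 0`, `w 1`, `w 2`. -/
def theta (w : Fin 3 → List (Fin 2 × Bool)) (hw : ∀ i, FreeGroup.IsReduced (w i))
    (h₀ : ∀ i, w i ≠ []) (h : ∀ i j, i ≠ j → Apart (w i) (w j)) : FoldedFatgraph (Fin 2) where
  Dart := Fin 3 × Bool
  flip := thetaFlip
  flip_flip := by decide
  flip_ne := by decide
  next := thetaNext
  label d := if d.2 then w d.1 else FreeGroup.invRev (w d.1)
  label_ne_nil := by
    have : ∀ i, FreeGroup.invRev (w i) ≠ [] := fun i e => h₀ i (by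
      rw [← FreeGroup.invRev_invRev (L₁ := w i), e, FreeGroup.invRev_empty])
    rintro ⟨i, _ | _⟩ <;> simp [h₀, this]
  label_flip := by
    rintro ⟨i, _ | _⟩ <;> simp [thetaFlip]
  label_reduced := by
    rintro ⟨i, _ | _⟩ <;> simp [hw, (hw i).invRev]
  folded := by
    have key : ∀ d e, thetaNext.SameCycle d e → d.2 = e.2 := by decide
    rintro ⟨i, b⟩ ⟨j, b'⟩ hs hne
    obtain rfl : b = b' := key _ _ hs
    have hij : i ≠ j := fun e => hne (by rw [e])
    cases b
    · simpa using (h i j hij).invRev.1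
    · simpa using (h i j hij).1

section Theta

variable {w : Fin 3 → List (Fin 2 × Bool)} {hw : ∀ i, FreeGroup.IsReduced (w i)}
  {h₀ : ∀ i, w i ≠ []} {h : ∀ i j, i ≠ j → Apart (w i) (w j)}

theorem boundaryComponents_theta :
    (theta w hw h₀ h).boundaryComponents =
      Finset.univ.image fun i : Fin 3 => Cycle.ofList [(i, true), (i - 1, false)] := by
  refine (cyclesOf_congr (p := thetaFlip.trans thetaNext)
    (c := fun d => ([d, thetaNext (thetaFlip d)] : List (Fin 3 × Bool)))
    fun d => periodicOrbit_eq_two ?_ ?_).trans ?_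
  · revert d
    decide
  · revert d
    decide
  · decide

theorem boundary_theta :
    (theta w hw h₀ h).boundary = {((w 0 ++ FreeGroup.invRev (w 2) : List _) : Cycle (Fin 2 × Bool)),
      ((w 1 ++ FreeGroup.invRev (w 0) : List _) : Cycle (Fin 2 × Bool)),
      ((w 2 ++ FreeGroup.invRev (w 1) : List _) : Cycle (Fin 2 × Bool))} := by
  rw [boundary, boundaryComponents_theta, Finset.image_val_of_injOn (by decide)]
  refine (Multiset.map_map (theta w hw h₀ h).cyclicWord
    (fun i : Fin 3 => Cycle.ofList [(i, true), (i - 1, false)]) _).trans ?_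
  refine (Multiset.map_congr rfl fun i _ => congrArg Cycle.ofList
    (congrArg (w i ++ ·) (List.append_nil _))).trans ?_
  rfl

theorem isGoodPants_theta {m : ℕ} (hm : ∀ i, (w i).length = m) :
    (theta w hw h₀ h).IsGoodPants (2 * m) := by
  refine ⟨⟨⟨⟨((0, true) : Fin 3 × Bool)⟩, ?_⟩, ?_, ?_⟩, ?_, ?_, ?_⟩
  · have key : ∀ d e : Fin 3 × Bool, e = d ∨ e = thetaNext d ∨ e = thetaNext (thetaNext d) ∨
        e = thetaFlip d ∨ e = thetaFlip (thetaNext d) ∨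
          e = thetaFlip (thetaNext (thetaNext d)) := by decide
    intro d e
    rcases key d e with rfl | rfl | rfl | rfl | rfl | rfl
    · exact .refl
    · exact .single (Or.inr rfl)
    · exact .tail (.single (Or.inr rfl)) (Or.inr rfl)
    · exact .single (Or.inl rfl)
    · exact .tail (.single (Or.inr rfl)) (Or.inl rfl)
    · exact .tail (.tail (.single (Or.inr rfl)) (Or.inr rfl)) (Or.inl rfl)
  · have e₁ : cyclesOf thetaNext = Finset.univ.image fun d : Fin 3 × Bool =>
        Cycle.ofList [d, thetaNext d, thetaNext (thetaNext d)] :=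
      cyclesOf_congr fun d => periodicOrbit_eq_three (by revert d; decide) (by revert d; decide)
    have e₂ : cyclesOf thetaFlip = Finset.univ.image fun d : Fin 3 × Bool =>
        Cycle.ofList [d, thetaFlip d] :=
      cyclesOf_congr fun d => periodicOrbit_eq_two (by revert d; decide) (by revert d; decide)
    change ((cyclesOf thetaNext).card : ℤ) - ((cyclesOf thetaFlip).card : ℤ) = -1
    rw [e₁, e₂]
    decide
  · rw [boundaryComponents_theta]
    change (Finset.univ.image fun i : Fin 3 => Cycle.ofList [(i, true), (i - 1, false)]).card = 3
    decide
  · intro v hv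
    obtain ⟨d, -, rfl⟩ := Finset.mem_image.1 hv
    rw [Function.periodicOrbit_length]
    have h₁ : ∀ d, thetaNext d ≠ d := by decide
    have h₂ : ∀ d, thetaNext (thetaNext (thetaNext d)) = d := by decide
    exact minimalPeriod_eq_three (h₁ d) (h₂ d)
  · rintro ⟨i, _ | _⟩ <;> simp [theta, hm]
  · have key : ∀ i j, i ≠ j → IsLoop (2 * m)
        ((w i ++ FreeGroup.invRev (w j) : List _) : Cycle (Fin 2 × Bool)) := fun i j hij =>
      isLoop_coe_iff.2 ⟨by simp [hm, two_mul],
        (h i j hij).isCyclicallyReduced (hw i) (hw j) (h₀ i) (h₀ j)⟩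
    rw [boundary_theta]
    simp only [Multiset.insert_eq_cons, Multiset.mem_cons, Multiset.mem_singleton]
    rintro c (rfl | rfl | rfl)
    · exact key _ _ (by decide)
    · exact key _ _ (by decide)
    · exact key _ _ (by decide)

end Theta

end FoldedFatgraph

/-! ### The group of bounding vectors -/

/-- The integral vectors which, up to a multiple of the uniform vector, bound a collection of good
pants and annuli. -/
def boundingVectors (L : ℕ) : AddSubmonoid (Loop (Fin 2) L → ℤ) where
  carrier := {z | ∃ (n : ℕ) (C : List (FoldedFatgraph (Fin 2))),
    (∀ Y ∈ C, Y.IsGoodPants L ∨ Y.IsGoodAnnulus L) ∧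
      ∀ γ, z γ + n = ((C.map FoldedFatgraph.boundary).sum.count γ.1 : ℕ)}
  zero_mem' := ⟨0, [], by simp, by simp⟩
  add_mem' := by
    rintro z z' ⟨n, C, hC, h⟩ ⟨n', C', hC', h'⟩
    refine ⟨n + n', C ++ C', ?_, fun γ => ?_⟩
    · intro Y hY
      exact (List.mem_append.1 hY).elim (hC Y) (hC' Y)
    · rw [List.map_append, List.sum_append, Multiset.count_add]
      push_cast
      rw [← h, ← h', Pi.add_apply]
      ring

/-- The indicator vector of a cyclic word: `1` at the loop that it represents, `0` elsewhere. -/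
def loopVector {L : ℕ} (c : Cycle (Fin 2 × Bool)) : Loop (Fin 2) L → ℤ :=
  fun γ => if γ.1 = c then 1 else 0

/-- The empty collection with n = 1. -/
theorem neg_one_mem_boundingVectors (L : ℕ) : -1 ∈ boundingVectors L :=
  ⟨1, [], by simp, by simp⟩

theorem annulus_mem_boundingVectors {L : ℕ} (hL : 0 < L) {l : List (Fin 2 × Bool)}
    (hl : FreeGroup.IsCyclicallyReduced l) (h : l.length = L) :
    loopVector l + loopVector (FreeGroup.invRev l) ∈ boundingVectors L := by
  subst h
  refine ⟨0, [FoldedFatgraph.annulus l hl (List.ne_nil_of_length_pos hL)], ?_, fun γ => ?_⟩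
  · simpa using Or.inr FoldedFatgraph.isGoodAnnulus_annulus
  · simp only [List.map_cons, List.map_nil, List.sum_cons, List.sum_nil, add_zero,
      FoldedFatgraph.boundary_annulus, Multiset.insert_eq_cons, Multiset.count_cons,
      Multiset.count_singleton, loopVector, Pi.add_apply]
    push_cast
    ring

theorem pants_mem_boundingVectors {m : ℕ} (hm : 0 < m) {x y z : List (Fin 2 × Bool)}
    (hx : FreeGroup.IsReduced x) (hy : FreeGroup.IsReduced y) (hz : FreeGroup.IsReduced z)
    (hxm : x.length = m) (hym : y.length = m) (hzm : z.length = m)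
    (hxy : Apart x y) (hyz : Apart y z) (hzx : Apart z x) :
    loopVector (x ++ FreeGroup.invRev y : List _) + loopVector (y ++ FreeGroup.invRev z : List _) +
      loopVector (z ++ FreeGroup.invRev x : List _) ∈ boundingVectors (2 * m) := by
  -- The faces of the theta graph are w i (w (i - 1))⁻¹, so the edges are listed as x, z, y.
  have hlen : ∀ i, (![x, z, y] i).length = m := by
    intro i
    fin_cases i <;> simp [hxm, hym, hzm]
  refine ⟨0, [FoldedFatgraph.theta ![x, z, y] ?_ ?_ ?_], ?_, fun γ => ?_⟩
  · intro i
    fin_cases i <;> simp [hx, hy, hz]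
  · intro i h
    have := hlen i
    rw [h, List.length_nil] at this
    omega
  · intro i j hij
    fin_cases i <;> fin_cases j <;>
      first
        | exact absurd rfl hij
        | simp [hxy, hyz, hzx, hxy.symm, hyz.symm, hzx.symm]
  · simpa using Or.inl (FoldedFatgraph.isGoodPants_theta hlen)
  · simp only [List.map_cons, List.map_nil, List.sum_cons, List.sum_nil, add_zero,
      FoldedFatgraph.boundary_theta, Multiset.insert_eq_cons, Multiset.count_cons,
      Multiset.count_singleton, loopVector, Pi.add_apply, Matrix.cons_val]
    push_cast
    ring

/-- The loop with the opposite orientation. -/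
def Loop.inverse {L : ℕ} (γ : Loop (Fin 2) L) : Loop (Fin 2) L :=
  ⟨(γ.1.map fun a => (a.1, !a.2)).reverse, by
    obtain ⟨c, hc⟩ := γ
    induction c using Quotient.inductionOn with
    | _ l =>
      have h := isLoop_coe_iff.1 hc
      exact isLoop_coe_iff.2 ⟨FreeGroup.invRev_length.trans h.1, h.2.invRev⟩⟩

theorem Loop.inverse_involutive {L : ℕ} :
    Function.Involutive (Loop.inverse : Loop (Fin 2) L → Loop (Fin 2) L) := by
  rintro ⟨c, hc⟩
  induction c using Quotient.inductionOn with
  | _ l => exact Subtype.ext (congrArg Cycle.ofList FreeGroup.invRev_invRev)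

theorem sum_loopVector (L : ℕ) : ∑ γ : Loop (Fin 2) L, loopVector (L := L) γ.1 = 1 := by
  ext δ
  rw [Finset.sum_apply, Finset.sum_eq_single δ]
  · simp [loopVector]
  · intro γ _ h
    simpa [loopVector, Subtype.ext_iff, eq_comm] using h
  · simp

/-- Inversion permutes the loops, so all annulus vectors add up to 2·𝟏'. The negative of one of them
is thus the sum of the others minus 2·𝟏'. -/
theorem neg_annulus_mem_boundingVectors {L : ℕ} (hL : 0 < L) {l : List (Fin 2 × Bool)}
    (hl : FreeGroup.IsCyclicallyReduced l) (h : l.length = L) :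
    -(loopVector l + loopVector (FreeGroup.invRev l)) ∈ boundingVectors L := by
  classical
  let β : Loop (Fin 2) L → Loop (Fin 2) L → ℤ := fun γ => loopVector γ.1 + loopVector γ.inverse.1
  have mem : ∀ γ, β γ ∈ boundingVectors L := by
    rintro ⟨c, hc⟩
    induction c using Quotient.inductionOn with
    | _ l =>
      have h := isLoop_coe_iff.1 hc
      exact annulus_mem_boundingVectors hL h.2 h.1
  have total : ∑ γ, β γ = 1 + 1 := by
    rw [Finset.sum_add_distrib, sum_loopVector,
      Loop.inverse_involutive.bijective.sum_comp fun γ : Loop (Fin 2) L => loopVector γ.1,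
      sum_loopVector]
  let γ₀ : Loop (Fin 2) L := ⟨l, isLoop_coe_iff.2 ⟨h, hl⟩⟩
  have key : -β γ₀ = ∑ γ ∈ Finset.univ.erase γ₀, β γ + (-1 + -1) := by
    rw [← Finset.add_sum_erase _ _ (Finset.mem_univ γ₀)] at total
    rw [eq_sub_of_add_eq' total]
    abel
  change -β γ₀ ∈ boundingVectors L
  rw [key]
  exact add_mem (sum_mem fun γ _ => mem γ)
    (add_mem (neg_one_mem_boundingVectors L) (neg_one_mem_boundingVectors L))

/-- Exchanging y and z gives pants whose boundary loops are the inverses of the original ones.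
Subtracting the three annuli that pair each loop with its inverse leaves the negative of the
original boundary. -/
theorem neg_pants_mem_boundingVectors {m : ℕ} (hm : 0 < m) {x y z : List (Fin 2 × Bool)}
    (hx : FreeGroup.IsReduced x) (hy : FreeGroup.IsReduced y) (hz : FreeGroup.IsReduced z)
    (hxm : x.length = m) (hym : y.length = m) (hzm : z.length = m)
    (hxy : Apart x y) (hyz : Apart y z) (hzx : Apart z x) :
    -(loopVector (x ++ FreeGroup.invRev y : List _) +
      loopVector (y ++ FreeGroup.invRev z : List _) +
      loopVector (z ++ FreeGroup.invRev x : List _)) ∈ boundingVectors (2 * m) := by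
  have ne : ∀ {x : List (Fin 2 × Bool)}, x.length = m → x ≠ [] := by
    rintro x h rfl
    rw [List.length_nil] at h
    omega
  have ann : ∀ {x y : List (Fin 2 × Bool)}, FreeGroup.IsReduced x → FreeGroup.IsReduced y →
      x.length = m → y.length = m → Apart x y →
      -(loopVector (x ++ FreeGroup.invRev y : List _) +
        loopVector (y ++ FreeGroup.invRev x : List _)) ∈ boundingVectors (2 * m) := by
    intro x y hx hy hxm hym h
    have := neg_annulus_mem_boundingVectors (L := 2 * m) (by omega)
      (h.isCyclicallyReduced hx hy (ne hxm) (ne hym)) (by simp [hxm, hym, two_mul])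
    rwa [FreeGroup.invRev_append, FreeGroup.invRev_invRev] at this
  have h := pants_mem_boundingVectors hm hx hz hy hxm hzm hym hzx.symm hyz.symm hxy.symm
  have := add_mem (add_mem (add_mem h (ann hx hy hxm hym hxy)) (ann hy hz hym hzm hyz))
    (ann hz hx hzm hxm hzx)
  convert this using 1
  abel

/-- The vectors which are bounding together with their negatives. -/
def boundingSubgroup (L : ℕ) : AddSubgroup (Loop (Fin 2) L → ℤ) where
  carrier := {z | z ∈ boundingVectors L ∧ -z ∈ boundingVectors L}
  zero_mem' := ⟨zero_mem _, by simp⟩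
  add_mem' := fun h h' => ⟨add_mem h.1 h'.1, by
    rw [neg_add]
    exact add_mem h.2 h'.2⟩
  neg_mem' := fun h => ⟨h.2, by simpa using h.1⟩

theorem isBoundaryCocycle_mk {m : ℕ} (hm : 0 < m) :
    IsBoundaryCocycle m fun l : List (Fin 2 × Bool) =>
      (QuotientAddGroup.mk (loopVector l) : (Loop (Fin 2) (2 * m) → ℤ) ⧸ boundingSubgroup (2 * m)) where
  rotate x y := by rw [Cycle.coe_eq_coe.2 List.isRotated_append]
  invRev l hl hlm := by
    rw [eq_neg_iff_add_eq_zero, add_comm, ← QuotientAddGroup.mk_add, QuotientAddGroup.eq_zero_iff]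
    exact ⟨annulus_mem_boundingVectors (by omega) hl hlm,
      neg_annulus_mem_boundingVectors (by omega) hl hlm⟩
  pants x y z hx hy hz hxm hym hzm hxy hyz hzx := by
    rw [← QuotientAddGroup.mk_add, ← QuotientAddGroup.mk_add, QuotientAddGroup.eq_zero_iff]
    exact ⟨pants_mem_boundingVectors hm hx hy hz hxm hym hzm hxy hyz hzx,
      neg_pants_mem_boundingVectors hm hx hy hz hxm hym hzm hxy hyz hzx⟩

/-! ### Homologically trivial vectors -/

theorem sum_map_eq_sum_count {A : Type*} [AddCommGroup A] (h : Fin 2 × Bool → A)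
    (l : List (Fin 2 × Bool)) :
    (l.map h).sum = ((l : Multiset (Fin 2 × Bool)).count (0, true) : ℤ) • h (0, true) +
      ((l : Multiset (Fin 2 × Bool)).count (0, false) : ℤ) • h (0, false) +
      ((l : Multiset (Fin 2 × Bool)).count (1, true) : ℤ) • h (1, true) +
      ((l : Multiset (Fin 2 × Bool)).count (1, false) : ℤ) • h (1, false) := by
  rw [← Multiset.sum_coe, ← Multiset.map_coe, Finset.sum_multiset_map_count,
    Finset.sum_subset (Finset.subset_univ _)]
  · rw [Fintype.sum_prod_type]
    simp only [Fin.sum_univ_two, Fintype.sum_bool, natCast_zsmul, add_assoc]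
  · intro a _ ha
    rw [Multiset.count_eq_zero_of_notMem (by simpa using ha), zero_smul]

theorem mem_boundingSubgroup {m : ℕ} (hm : 2 ≤ m) (z : Loop (Fin 2) (2 * m) → ℤ)
    (hz : ∀ i, ∑ γ, z γ * ((γ.1.toMultiset.count (i, true) : ℤ) - γ.1.toMultiset.count (i, false)) = 0) :
    z ∈ boundingSubgroup (2 * m) := by
  classical
  obtain ⟨h, e, he, hψ⟩ := (isBoundaryCocycle_mk (m := m) (by omega)).exists_eq_sum hm
  let k : Loop (Fin 2) (2 * m) → Fin 2 × Bool → ℤ := fun γ p => γ.1.toMultiset.count p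
  have hk : ∀ γ, k γ (0, true) + k γ (0, false) + k γ (1, true) + k γ (1, false) = 2 * m := by
    rintro ⟨c, hc⟩
    induction c using Quotient.inductionOn with
    | _ l =>
      have h₁ := sum_map_eq_sum_count (fun _ => (1 : ℤ)) l
      have h₂ := (isLoop_coe_iff.1 hc).1
      simp only [List.map_const', List.sum_replicate, smul_eq_mul, mul_one, nsmul_eq_mul, h₂,
        Nat.cast_mul, Nat.cast_ofNat] at h₁
      exact h₁.symm
  -- Inverse letters are eliminated by h(p⁻¹) = e - h(p), which leaves exponent sums and a multiple
  -- of e.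
  have value : ∀ γ : Loop (Fin 2) (2 * m),
      (QuotientAddGroup.mk (loopVector γ.1) :
        (Loop (Fin 2) (2 * m) → ℤ) ⧸ boundingSubgroup (2 * m)) =
      (k γ (0, true) - k γ (0, false)) • h (0, true) +
        (k γ (1, true) - k γ (1, false)) • h (1, true) +
        (k γ (0, false) + k γ (1, false) - m) • e := by
    rintro ⟨c, hc⟩
    induction c using Quotient.inductionOn with
    | _ l =>
      have h₁ := isLoop_coe_iff.1 hc
      have h₂ := hψ l h₁.2 h₁.1
      have e₀ : h (0, false) = e - h (0, true) := eq_sub_of_add_eq' (he (0, true))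
      have e₁ : h (1, false) = e - h (1, true) := eq_sub_of_add_eq' (he (1, true))
      rw [sum_map_eq_sum_count, e₀, e₁] at h₂
      refine h₂.trans ?_
      let n : Fin 2 × Bool → ℤ := fun p => (l : Multiset (Fin 2 × Bool)).count p
      change n (0, true) • h (0, true) + n (0, false) • (e - h (0, true)) +
        n (1, true) • h (1, true) + n (1, false) • (e - h (1, true)) - m • e =
        (n (0, true) - n (0, false)) • h (0, true) + (n (1, true) - n (1, false)) • h (1, true) +
        (n (0, false) + n (1, false) - m) • e
      rw [← natCast_zsmul]
      module
  have decomp : z = ∑ γ, z γ • loopVector γ.1 := by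
    ext δ
    rw [Finset.sum_apply, Finset.sum_eq_single δ]
    · simp [loopVector]
    · intro γ _ h
      rw [Pi.smul_apply, loopVector, if_neg fun e => h (Subtype.ext e.symm), smul_zero]
    · simp
  have hz₀ : ∑ γ, z γ * (k γ (0, true) - k γ (0, false)) = 0 := hz 0
  have hz₁ : ∑ γ, z γ * (k γ (1, true) - k γ (1, false)) = 0 := hz 1
  -- Since a loop has 2m letters, twice the coefficient of e is minus the total exponent sum.
  have hz₂ : ∑ γ, z γ * (k γ (0, false) + k γ (1, false) - m) = 0 := by
    have : 2 * ∑ γ, z γ * (k γ (0, false) + k γ (1, false) - m) =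
        -(∑ γ, z γ * (k γ (0, true) - k γ (0, false)) +
          ∑ γ, z γ * (k γ (1, true) - k γ (1, false))) := by
      rw [← Finset.sum_add_distrib, ← Finset.sum_neg_distrib, Finset.mul_sum]
      refine Finset.sum_congr rfl fun γ _ => ?_
      linear_combination z γ * hk γ
    rw [hz₀, hz₁] at this
    omega
  rw [← QuotientAddGroup.eq_zero_iff, decomp]
  change QuotientAddGroup.mk' _ _ = _
  rw [map_sum]
  have : ∀ γ, QuotientAddGroup.mk' (boundingSubgroup (2 * m)) (z γ • loopVector γ.1) =
      (z γ * (k γ (0, true) - k γ (0, false))) • h (0, true) +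
        (z γ * (k γ (1, true) - k γ (1, false))) • h (1, true) +
        (z γ * (k γ (0, false) + k γ (1, false) - m)) • e := by
    intro γ
    rw [map_zsmul]
    refine (congrArg (z γ • ·) (value γ)).trans ?_
    have smul : ∀ {A : Type} [AddCommGroup A] (n a b c : ℤ) (x y w : A),
        n • (a • x + b • y + c • w) = (n * a) • x + (n * b) • y + (n * c) • w := by
      intros
      module
    exact smul _ _ _ _ _ _ _
  rw [Finset.sum_congr rfl fun γ _ => this γ, Finset.sum_add_distrib, Finset.sum_add_distrib,
    ← Finset.sum_smul, ← Finset.sum_smul, ← Finset.sum_smul, hz₀, hz₁, hz₂]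
  simp

theorem proposition4p1p2 (L : ℕ) (hL : 0 < L) (hL4 : 4 ∣ L)
    (v : Loop (Fin 2) L → ℚ) (hv : v ∈ homologicallyTrivial (Fin 2) L)
    (hint : IsIntegralVector v) :
    ∃ n : ℕ, BoundsGoodPantsAndAnnuli (v + (n : ℚ) • uniformVector (Fin 2) L) := by
  obtain ⟨k, rfl⟩ := hL4
  obtain ⟨m, hm⟩ : ∃ m, 4 * k = 2 * m := ⟨2 * k, by ring⟩
  have hm₂ : 2 ≤ m := by omega
  clear hL
  revert v
  rw [hm]
  intro v hv hint
  choose z hz using hint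
  obtain ⟨n, C, hC, h⟩ := (mem_boundingSubgroup hm₂ z fun i => by
    have := congrFun (LinearMap.mem_ker.1 hv) i
    simp only [homologyMap, Fintype.linearCombination_apply, Finset.sum_apply, Pi.smul_apply, hz,
      homologyClass, smul_eq_mul, Pi.zero_apply] at this
    exact_mod_cast this).1
  refine ⟨n, C, hC, fun γ => ?_⟩
  have := congrArg (Int.cast : ℤ → ℚ) (h γ)
  push_cast at this
  simpa [uniformVector, hz] using this
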